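/- Let $n\ge 1$. Let $SU(n,1)$ be the group of matrices $g\in GL_{n+1}(\mathbb C)$ with $\det g=1$ and $g^*Jg=J$, where $J=\mathrm{diag}(1,\dots,1,-1)$. Arithmetic lattices. Let $K$ be a totally real number field, $l/K$ a totally complex quadratic extension, and $A$ a central simple $l$-algebra of degree $d$ with an involution $*$ of the second kind whose restriction to $l$ has fixed field $K$. Let $rd=n+1$, extend $*$ to the matrix algebra $M(r,A)$ by $*$-transposition, and let $h\in M(r,A)$ be invertible with $h^*=h$. For an embedding $\tau:l\to\mathbb C$, identify $M(r,A)\otimes_{l,\tau}\mathbb C$ with $M(n+1,\mathbb C)$; the involution is then adjunction with respect to a nondegenerate Hermitian form $E_\tau$ on $\mathbb{C}^{n+1}$ (unique up to a nonzero real factor), and $h$ gives the Hermitian form $h^\tau=E_\tau h$. Suppose that for one embedding $\tau_1$ the form $h^{\tau_1}$ has, for a suitable choice of the sign of $E_{\tau_1}$, signature $(n,1)$, and identify $SU(h^{\tau_1})$ with $SU(n,1)$ by a choice of coordinates; suppose that $SU(h^{\tau})$ is compact for every $\tau$ with $\tau|_K\ne\tau_1|_K$. Let $\mathcal O$ be an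 $\mathcal O_l$-order in $A$. Write $SU(h)=\{x\in M(r,A)^\times : x^*hx=h,\ \mathrm{Nrd}(x)=1\}$, which is the group of $K$-points of the corresponding algebraic $K$-group, and $SU(h,\mathcal O)=SU(h)\cap GL(r,\mathcal O)$, both regarded as subgroups of $SU(n,1)$ through $\tau_1$. An arithmetic lattice over $K$ is a subgroup $\Gamma\subset SU(n,1)$ that is contained in $SU(h)$ and commensurable with $SU(h,\mathcal O)$, for some data as above. An element of $SU(n,1)$ is called hyperbolic if it has no fixed point in complex hyperbolic $n$-space (the set of negative lines in $\mathbb C^{n+1}$ for $J$) and exactly two fixed points on its boundary (the set of null lines). A complex number $\lambda=re^{i\theta}$ with $r>1$ is called a complex Salem number if it is a root of a monic polynomial with integer coefficients all of whose roots other than $\lambda,\bar\lambda,\lambda^{-1},\bar\lambda^{-1}$ lie on the unit circle (equivalently, $\lambda$ is an algebraic integer all of whose conjugates other than these lie on the unit circle). Theorem. Let $\Gamma\subset SU(n,1)$ be an arithmetic lattice over $K$ and let $\gamma\in\Gamma$ be hyperbolic. Then $\gamma$ has a unique eigenvalue of largest absolute value, and this eigenvalue is a complex Salem number. -/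

import Mathlib

open scoped Matrix Polynomial LinearAlgebra.Projectivization

namespace ComplexHyperbolic

noncomputable section

/-! ### Complex Salem numbers -/

/-- `z` is a complex Salem number: `‖z‖ > 1`, and `z` is a root of a monic integer polynomial all of
whose roots other than `z`, its conjugate, and the inverses of these two lie on the unit circle. -/
def IsComplexSalem (z : ℂ) : Prop :=
  1 < ‖z‖ ∧ ∃ p : ℤ[X], p.Monic ∧ Polynomial.aeval z p = 0 ∧
    ∀ w : ℂ, Polynomial.aeval w p = 0 →
      w ≠ z → w ≠ star z → w ≠ z⁻¹ → w ≠ (star z)⁻¹ → ‖w‖ = 1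

/-! ### The group `SU(n,1)` and its hyperbolic elements -/

/-- The diagonal matrix `diag(1, …, 1, -1)` of size `n + 1`. -/
def stdForm (n : ℕ) : Matrix (Fin (n + 1)) (Fin (n + 1)) ℂ :=
  Matrix.diagonal fun i => if i = Fin.last n then -1 else 1

/-- The special unitary group of the complex sesquilinear form with matrix `H`. -/
def specialUnitary {m : ℕ} (H : Matrix (Fin m) (Fin m) ℂ) : Subgroup (GL (Fin m) ℂ) where
  carrier := {g | (g : Matrix (Fin m) (Fin m) ℂ)ᴴ * H * (g : Matrix (Fin m) (Fin m) ℂ) = H ∧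
    (g : Matrix (Fin m) (Fin m) ℂ).det = 1}
  one_mem' := by simp
  mul_mem' := by
    rintro a b ⟨ha, ha'⟩ ⟨hb, hb'⟩
    refine ⟨?_, by simp [ha', hb']⟩
    rw [Units.val_mul, Matrix.conjTranspose_mul]
    calc _ = (b : Matrix (Fin m) (Fin m) ℂ)ᴴ *
          ((a : Matrix (Fin m) (Fin m) ℂ)ᴴ * H * (a : Matrix (Fin m) (Fin m) ℂ)) *
          (b : Matrix (Fin m) (Fin m) ℂ) := by simp only [mul_assoc]
      _ = H := by rw [ha, hb]
  inv_mem' := by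
    rintro a ⟨ha, ha'⟩
    have h1 : (a : Matrix (Fin m) (Fin m) ℂ) * ((a⁻¹ : GL (Fin m) ℂ) : Matrix _ _ ℂ) = 1 :=
      a.mul_inv
    have h2 : ((a⁻¹ : GL (Fin m) ℂ) : Matrix _ _ ℂ)ᴴ * (a : Matrix (Fin m) (Fin m) ℂ)ᴴ = 1 := by
      rw [← Matrix.conjTranspose_mul, h1, Matrix.conjTranspose_one]
    refine ⟨?_, ?_⟩
    · calc _ = ((a⁻¹ : GL (Fin m) ℂ) : Matrix _ _ ℂ)ᴴ *
            ((a : Matrix (Fin m) (Fin m) ℂ)ᴴ * H * (a : Matrix (Fin m) (Fin m) ℂ)) *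
            ((a⁻¹ : GL (Fin m) ℂ) : Matrix _ _ ℂ) := by rw [ha]
        _ = (((a⁻¹ : GL (Fin m) ℂ) : Matrix _ _ ℂ)ᴴ * (a : Matrix (Fin m) (Fin m) ℂ)ᴴ) * H *
            ((a : Matrix (Fin m) (Fin m) ℂ) * ((a⁻¹ : GL (Fin m) ℂ) : Matrix _ _ ℂ)) := by
          simp only [mul_assoc]
        _ = H := by rw [h1, h2, one_mul, mul_one]
    · have h3 := congrArg Matrix.det h1
      rwa [Matrix.det_mul, ha', one_mul, Matrix.det_one] at h3

/-- The group `SU(n,1)`. -/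
abbrev SUn1 (n : ℕ) : Subgroup (GL (Fin (n + 1)) ℂ) := specialUnitary (stdForm n)

/-- The value `|v₁|² + ⋯ + |vₙ|² - |vₙ₊₁|²`. -/
def normForm (n : ℕ) (v : Fin (n + 1) → ℂ) : ℝ := (star v ⬝ᵥ (stdForm n *ᵥ v)).re

/-- Complex hyperbolic space: the negative lines in `ℂⁿ⁺¹`. -/
def hyperbolicSpace (n : ℕ) : Set (ℙ ℂ (Fin (n + 1) → ℂ)) := {p | normForm n p.rep < 0}

/-- The boundary at infinity of complex hyperbolic space: the null lines in `ℂⁿ⁺¹`. -/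
def boundary (n : ℕ) : Set (ℙ ℂ (Fin (n + 1) → ℂ)) := {p | normForm n p.rep = 0}

/-- The points of projective space fixed by an invertible matrix. -/
def fixedLines {n : ℕ} (g : GL (Fin (n + 1)) ℂ) : Set (ℙ ℂ (Fin (n + 1) → ℂ)) :=
  {p | p.submodule.map (Matrix.toLin' (g : Matrix (Fin (n + 1)) (Fin (n + 1)) ℂ)) = p.submodule}

/-- `g ∈ SU(n,1)` is hyperbolic (loxodromic): as an isometry it has no fixed point in complex
hyperbolic space and exactly two fixed points on the boundary. -/
def IsHyperbolic {n : ℕ} (g : GL (Fin (n + 1)) ℂ) : Prop :=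
  g ∈ SUn1 n ∧ fixedLines g ∩ hyperbolicSpace n = ∅ ∧ (fixedLines g ∩ boundary n).encard = 2

/-! ### Arithmetic lattices in `SU(n,1)` -/

/-- `O` is an order of the `l`-algebra `A` over the ring of integers of `l`: a subring that contains
the integers of `l`, is finitely generated (over `ℤ`, equivalently over the integers of `l`), and
spans `A` over `l`. -/
structure IsOrder (l : Type*) {A : Type*} [Field l] [Ring A] [Algebra l A] (O : Subring A) :
    Prop where
  algebraMap_mem : ∀ a : NumberField.RingOfIntegers l, algebraMap l A (a : l) ∈ O
  fg : O.toAddSubgroup.FG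
  span_eq_top : Submodule.span l (O : Set A) = ⊤

/-- The involution `star` of `A` is of the second kind with fixed field `K`: the elements
of the centre `l` that it fixes are exactly those of `K`. -/
def IsSecondKind (K l A : Type*) [Field K] [Field l] [Algebra K l] [Ring A] [Algebra l A]
    [StarRing A] : Prop :=
  ∀ a : l, star (algebraMap l A a) = algebraMap l A a ↔ a ∈ (algebraMap K l).range

/-- A splitting at `τ : l → ℂ` of the `l`-algebra `M(r, A)` with involution `x ↦ xᴴ` (the `star`
of `A` applied to the entries of the transpose). The map `toHom` is `l`-linear, so it
identifies `M(r, A) ⊗_{l, τ} ℂ` with `M(m, ℂ)` when `A` is central simple of degree `m / r`,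
and the involution becomes the adjunction with respect to the Hermitian form with matrix `E`. -/
structure Splitting {l A : Type*} [Field l] [Ring A] [Algebra l A] [StarRing A]
    (τ : l →+* ℂ) (r m : ℕ) where
  toHom : Matrix (Fin r) (Fin r) A →+* Matrix (Fin m) (Fin m) ℂ
  map_scalar : ∀ a : l, toHom (algebraMap l (Matrix (Fin r) (Fin r) A) a) =
    Matrix.scalar (Fin m) (τ a)
  E : Matrix (Fin m) (Fin m) ℂ
  isHermitian : E.IsHermitian
  isUnit : IsUnit E
  adjoint : ∀ x, E * toHom xᴴ = (toHom x)ᴴ * E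

namespace Splitting

variable {l A : Type*} [Field l] [Ring A] [Algebra l A] [StarRing A] {τ : l →+* ℂ} {r m : ℕ}

/-- The complex Hermitian form `h^τ` that corresponds to `h`. For `A = l` with complex conjugation,
`toHom` the entrywise application of `τ`, and `E = 1`, it is the matrix `τ(h)`. -/
def form (s : Splitting (A := A) τ r m) (h : Matrix (Fin r) (Fin r) A) :
    Matrix (Fin m) (Fin m) ℂ := s.E * s.toHom h

/-- The group `SU(h)` of all `x` in `M(r, A)ˣ` with `x* h x = h` and reduced norm `1` (the reduced
norm is the determinant in a splitting). -/
def rationalPoints (s : Splitting (A := A) τ r m) (h : Matrix (Fin r) (Fin r) A) :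
    Subgroup (Matrix (Fin r) (Fin r) A)ˣ where
  carrier := {x | (x : Matrix (Fin r) (Fin r) A)ᴴ * h * (x : Matrix (Fin r) (Fin r) A) = h ∧
    (s.toHom x).det = 1}
  one_mem' := by simp
  mul_mem' := by
    rintro a b ⟨ha, ha'⟩ ⟨hb, hb'⟩
    refine ⟨?_, by simp [ha', hb']⟩
    rw [Units.val_mul, Matrix.conjTranspose_mul]
    calc _ = (b : Matrix (Fin r) (Fin r) A)ᴴ *
          ((a : Matrix (Fin r) (Fin r) A)ᴴ * h * (a : Matrix (Fin r) (Fin r) A)) *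
          (b : Matrix (Fin r) (Fin r) A) := by simp only [mul_assoc]
      _ = h := by rw [ha, hb]
  inv_mem' := by
    rintro a ⟨ha, ha'⟩
    have h1 : (a : Matrix (Fin r) (Fin r) A) * (a⁻¹ : (Matrix (Fin r) (Fin r) A)ˣ).val = 1 :=
      a.mul_inv
    have h2 : ((a⁻¹ : (Matrix (Fin r) (Fin r) A)ˣ).val)ᴴ * (a : Matrix (Fin r) (Fin r) A)ᴴ = 1 := by
      rw [← Matrix.conjTranspose_mul, h1, Matrix.conjTranspose_one]
    refine ⟨?_, ?_⟩
    · calc _ = ((a⁻¹ : (Matrix (Fin r) (Fin r) A)ˣ).val)ᴴ *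
            ((a : Matrix (Fin r) (Fin r) A)ᴴ * h * (a : Matrix (Fin r) (Fin r) A)) *
            (a⁻¹ : (Matrix (Fin r) (Fin r) A)ˣ).val := by rw [ha]
        _ = (((a⁻¹ : (Matrix (Fin r) (Fin r) A)ˣ).val)ᴴ * (a : Matrix (Fin r) (Fin r) A)ᴴ) * h *
            ((a : Matrix (Fin r) (Fin r) A) * (a⁻¹ : (Matrix (Fin r) (Fin r) A)ˣ).val) := by
          simp only [mul_assoc]
        _ = h := by rw [h1, h2, one_mul, mul_one]
    · have h3 := congrArg (fun y => (s.toHom y).det) h1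
      simp only [map_mul, Matrix.det_mul, ha', one_mul, map_one, Matrix.det_one] at h3
      exact h3

/-- The group `SU(h, O)` of all `x` in `SU(h)` that lie, with their inverses, in `M(r, O)`. -/
def integralPoints (s : Splitting (A := A) τ r m) (h : Matrix (Fin r) (Fin r) A)
    (O : Subring A) : Subgroup (Matrix (Fin r) (Fin r) A)ˣ :=
  s.rationalPoints h ⊓ (O.matrix (n := Fin r)).toSubmonoid.units

end Splitting

/-- `Γ ⊂ SU(n,1)` is an arithmetic lattice over `K`, built from the central simple `l`-algebra `A`
with involution `star`. There are

* numbers `r`, `d` with `dim_l A = d²` and `r d = n + 1`, and an order `O` of `A`,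
* an invertible Hermitian `h` in `M(r, A)`,
* an embedding `τ₁` of `l` in `ℂ` at which `h` has signature `(n,1)`; the splitting is taken in
  coordinates in which the form is the standard one, so that `SU(h, A ⊗ ℂ) = SU(n,1)`,

such that `SU(h^τ)` is compact for each embedding `τ` that differs from `τ₁` on `K`, and
`Γ` is a subgroup of the group of `K`-points `SU(h)`, commensurable with `SU(h, O)`.

Lattices of the first type are those with `A = l`, `r = n + 1`, and the second type has `r = 1`. -/
def IsArithmeticLattice (K l A : Type*) [Field K] [Field l] [Algebra K l] [Ring A] [Algebra l A]
    [StarRing A] {n : ℕ} (Γ : Subgroup (GL (Fin (n + 1)) ℂ)) : Prop :=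
  IsSecondKind K l A ∧
  ∃ (r d : ℕ) (h : Matrix (Fin r) (Fin r) A) (O : Subring A) (τ₁ : l →+* ℂ)
    (s₁ : Splitting (A := A) τ₁ r (n + 1)),
    Module.finrank l A = d ^ 2 ∧ r * d = n + 1 ∧ hᴴ = h ∧ IsUnit h ∧ IsOrder l O ∧
    s₁.form h = stdForm n ∧
    (∀ τ : l →+* ℂ, τ.comp (algebraMap K l) ≠ τ₁.comp (algebraMap K l) →
      ∃ s : Splitting (A := A) τ r (n + 1),
        IsCompact (specialUnitary (s.form h) : Set (GL (Fin (n + 1)) ℂ))) ∧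
    Γ ≤ SUn1 n ∧
    Γ ≤ (s₁.rationalPoints h).map (Units.map (s₁.toHom : _ →* _)) ∧
    Subgroup.Commensurable Γ ((s₁.integralPoints h O).map (Units.map (s₁.toHom : _ →* _)))

end

end ComplexHyperbolic

/-! If a hyperbolic `γ` had its two fixed null lines with eigenvalues of modulus one, these
eigenvalues would agree and some negative line spanned inside their sum would be fixed. So one null
eigenvector `u` has an eigenvalue `z` with `‖z‖ > 1`. Since orthogonal null vectors are
proportional, every other eigenvalue is `(star z)⁻¹` or has modulus one (`eigenvalue_trichotomy`),
and `z` is strictly dominant.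

For the Salem property, write `γ` as the image of `x` in `M(r, A)`. A power of `γ` comes from
matrices over the order, so `z` is an algebraic integer. The minimal polynomial of `x` over `l` has,
under each embedding `τ`, exactly the eigenvalues of `x` in a splitting at `τ` as roots
(`eval₂_minpoly_eq_zero_iff`, through linear disjointness for central simple algebras). A Galois
conjugate `w` of `z` is therefore an eigenvalue of `x` at some `τ`
(`exists_embedding_of_minpoly_eq`). If `τ` differs from `τ₁` on `K`, compactness forces `‖w‖ = 1`.
Otherwise `τ` is `τ₁` or its complex conjugate, and the trichotomy applies to `w` or to `star w`. -/

namespace ComplexHyperbolic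

/-! ### Hermitian geometry of `SU(n,1)` -/

section Hermitian

variable {n : ℕ}

/-- The standard Hermitian form of signature `(n, 1)`, conjugate-linear in the first variable. -/
noncomputable def herm (n : ℕ) (u v : Fin (n + 1) → ℂ) : ℂ := star u ⬝ᵥ (stdForm n *ᵥ v)

theorem herm_eq_sum (u v : Fin (n + 1) → ℂ) :
    herm n u v = ∑ i : Fin n, star (u i.castSucc) * v i.castSucc -
      star (u (Fin.last n)) * v (Fin.last n) := by
  simp [herm, stdForm, dotProduct, Matrix.mulVec_diagonal, Fin.sum_univ_castSucc,
    (Fin.castSucc_lt_last _).ne, sub_eq_add_neg]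

theorem normForm_eq (v : Fin (n + 1) → ℂ) : normForm n v = (herm n v v).re := rfl

theorem herm_add_right (u v w : Fin (n + 1) → ℂ) :
    herm n u (v + w) = herm n u v + herm n u w := by
  simp [herm, Matrix.mulVec_add]

theorem herm_smul_right (c : ℂ) (u v : Fin (n + 1) → ℂ) :
    herm n u (c • v) = c * herm n u v := by
  simp [herm, Matrix.mulVec_smul]

theorem star_herm (u v : Fin (n + 1) → ℂ) : star (herm n u v) = herm n v u := by
  simp [herm_eq_sum, mul_comm]

theorem herm_add_left (u v w : Fin (n + 1) → ℂ) :
    herm n (u + v) w = herm n u w + herm n v w := by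
  simp [herm, add_dotProduct]

theorem herm_smul_left (c : ℂ) (u v : Fin (n + 1) → ℂ) :
    herm n (c • u) v = star c * herm n u v := by
  simp [herm, smul_dotProduct]

theorem herm_self_im (v : Fin (n + 1) → ℂ) : (herm n v v).im = 0 :=
  Complex.conj_eq_iff_im.1 (star_herm v v)

theorem herm_self_eq_zero {v : Fin (n + 1) → ℂ} (hv : normForm n v = 0) : herm n v v = 0 :=
  Complex.ext hv (herm_self_im v)

theorem normForm_smul (c : ℂ) (v : Fin (n + 1) → ℂ) :
    normForm n (c • v) = ‖c‖ ^ 2 * normForm n v := by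
  have h : star c * (c * herm n v v) = ((‖c‖ ^ 2 : ℝ) : ℂ) * herm n v v := by
    rw [← mul_assoc, Complex.star_def, Complex.conj_mul', Complex.ofReal_pow]
  rw [normForm_eq, normForm_eq, herm_smul_left, herm_smul_right, h, Complex.re_ofReal_mul]

theorem herm_mulVec {g : GL (Fin (n + 1)) ℂ} (hg : g ∈ SUn1 n) (u v : Fin (n + 1) → ℂ) :
    herm n (g.val *ᵥ u) (g.val *ᵥ v) = herm n u v := by
  have h := hg.1
  rw [herm, Matrix.star_mulVec, Matrix.mulVec_mulVec, ← Matrix.dotProduct_mulVec,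
    Matrix.mulVec_mulVec, ← mul_assoc, h, herm]

/-- The form is positive definite on the hyperplane where the last coordinate vanishes. -/
theorem eq_zero_of_last_eq_zero {v : Fin (n + 1) → ℂ} (hv : herm n v v = 0)
    (h0 : v (Fin.last n) = 0) : v = 0 := by
  have h : ∑ i : Fin n, ‖v i.castSucc‖ ^ 2 = 0 := by
    have h := congrArg Complex.re hv
    rw [herm_eq_sum, h0] at h
    simpa [Complex.conj_mul', ← Complex.ofReal_pow] using h
  rw [Finset.sum_eq_zero_iff_of_nonneg fun _ _ => by positivity] at h
  ext i
  refine Fin.lastCases h0 (fun i => ?_) i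
  simpa using h i (Finset.mem_univ i)

/-- Orthogonal null vectors are proportional. -/
theorem exists_smul_eq_of_null {u v : Fin (n + 1) → ℂ} (hu0 : u ≠ 0) (hu : herm n u u = 0)
    (hv : herm n v v = 0) (huv : herm n u v = 0) : ∃ c : ℂ, v = c • u := by
  have hl : u (Fin.last n) ≠ 0 := fun h => hu0 (eq_zero_of_last_eq_zero hu h)
  have hvu : herm n v u = 0 := by rw [← star_herm, huv, star_zero]
  refine ⟨v (Fin.last n) / u (Fin.last n), ?_⟩
  -- This `c` cancels the last coordinate of `v - c • u`, which is again null.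
  set c := v (Fin.last n) / u (Fin.last n) with hc
  have h : v + (-c) • u = 0 := by
    apply eq_zero_of_last_eq_zero
    · simp only [herm_add_left, herm_add_right, herm_smul_left, herm_smul_right, hu, hv, huv, hvu,
        mul_zero, add_zero]
    · simp [hc, div_mul_cancel₀ _ hl]
  rw [neg_smul] at h
  exact add_neg_eq_zero.1 h

theorem exists_mulVec_eq_of_mem_fixedLines {g : GL (Fin (n + 1)) ℂ}
    {p : ℙ ℂ (Fin (n + 1) → ℂ)} (hp : p ∈ fixedLines g) :
    ∃ a : ℂ, g.val *ᵥ p.rep = a • p.rep := by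
  have h : Matrix.toLin' g.val p.rep ∈ p.submodule := by
    rw [← (show _ = p.submodule from hp)]
    apply Submodule.mem_map_of_mem
    rw [Projectivization.submodule_eq]
    exact Submodule.mem_span_singleton_self _
  rw [Projectivization.submodule_eq, Submodule.mem_span_singleton] at h
  obtain ⟨a, ha⟩ := h
  exact ⟨a, by rw [ha, Matrix.toLin'_apply]⟩

theorem mulVec_injective (g : GL (Fin (n + 1)) ℂ) {v : Fin (n + 1) → ℂ}
    (h : g.val *ᵥ v = 0) : v = 0 := by
  have h1 : g⁻¹.val *ᵥ (g.val *ᵥ v) = v := by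
    rw [Matrix.mulVec_mulVec, ← Units.val_mul, inv_mul_cancel, Units.val_one, Matrix.one_mulVec]
  rw [← h1, h, Matrix.mulVec_zero]

theorem mk_mem_fixedLines {g : GL (Fin (n + 1)) ℂ} {v : Fin (n + 1) → ℂ} (hv : v ≠ 0) {a : ℂ}
    (h : g.val *ᵥ v = a • v) : Projectivization.mk ℂ v hv ∈ fixedLines g := by
  have ha : a ≠ 0 := by
    rintro rfl
    exact hv (mulVec_injective g (by rw [h, zero_smul]))
  change Submodule.map _ _ = _
  rw [Projectivization.submodule_mk, Submodule.map_span, Set.image_singleton,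
    Matrix.toLin'_apply, h, Submodule.span_singleton_smul_eq (IsUnit.mk0 a ha)]

theorem mk_mem_hyperbolicSpace {v : Fin (n + 1) → ℂ} (hv : v ≠ 0) (h : normForm n v < 0) :
    Projectivization.mk ℂ v hv ∈ hyperbolicSpace n := by
  obtain ⟨c, hc⟩ := Projectivization.exists_smul_eq_mk_rep ℂ v hv
  change normForm n _ < 0
  rw [← hc, Units.smul_def, normForm_smul]
  have : 0 < ‖(c : ℂ)‖ := norm_pos_iff.2 c.ne_zero
  exact mul_neg_of_pos_of_neg (by positivity) h

/-- A hyperbolic element has a null eigenvector whose eigenvalue has modulus greater than one. -/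
theorem IsHyperbolic.exists_eigenvectors {g : GL (Fin (n + 1)) ℂ} (hg : IsHyperbolic g) :
    ∃ (z : ℂ) (u : Fin (n + 1) → ℂ), 1 < ‖z‖ ∧ u ≠ 0 ∧ herm n u u = 0 ∧
      g.val *ᵥ u = z • u := by
  obtain ⟨hSU, hneg, hbd⟩ := hg
  obtain ⟨p, q, hpq, hset⟩ := Set.encard_eq_two.1 hbd
  have hp : p ∈ fixedLines g ∩ boundary n := by simp [hset]
  have hq : q ∈ fixedLines g ∩ boundary n := by simp [hset]
  obtain ⟨a, ha⟩ := exists_mulVec_eq_of_mem_fixedLines hp.1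
  obtain ⟨b, hb⟩ := exists_mulVec_eq_of_mem_fixedLines hq.1
  have hpp := herm_self_eq_zero hp.2
  have hqq := herm_self_eq_zero hq.2
  have hpq0 : herm n p.rep q.rep ≠ 0 := by
    intro h0
    obtain ⟨c, hc⟩ := exists_smul_eq_of_null p.rep_nonzero hpp hqq h0
    apply hpq
    rw [← p.mk_rep, ← q.mk_rep, eq_comm, Projectivization.mk_eq_mk_iff']
    exact ⟨c, hc.symm⟩
  have hab : star a * b = 1 := by
    have h := herm_mulVec hSU p.rep q.rep
    rw [ha, hb, herm_smul_left, herm_smul_right, ← mul_assoc] at h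
    exact mul_right_cancel₀ hpq0 (h.trans (one_mul _).symm)
  have hnab : ‖a‖ * ‖b‖ = 1 := by simpa using congrArg norm hab
  have ha1 : ‖a‖ ≠ 1 := by
    intro h1
    have hba : b = a := by
      have h2 : star a * a = 1 := by
        rw [Complex.star_def, Complex.conj_mul', h1]; simp
      have h3 : star a ≠ 0 := left_ne_zero_of_mul (hab.trans_ne one_ne_zero)
      exact mul_left_cancel₀ h3 (hab.trans h2.symm)
    rw [hba] at hb
    -- With `a = b` the whole span of the two null vectors is an eigenspace. This `t` makes both
    -- cross terms equal to `-‖herm n p.rep q.rep‖ ^ 2`, so the combination is negative and its line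
    -- is a forbidden fixed point.
    set t := -star (herm n p.rep q.rep) with ht
    have hfix : g.val *ᵥ (p.rep + t • q.rep) = a • (p.rep + t • q.rep) := by
      rw [Matrix.mulVec_add, Matrix.mulVec_smul, ha, hb, smul_add, smul_comm]
    have hN : normForm n (p.rep + t • q.rep) < 0 := by
      have hqp : herm n q.rep p.rep = star (herm n p.rep q.rep) := (star_herm _ _).symm
      have : herm n (p.rep + t • q.rep) (p.rep + t • q.rep) =
          ((-2 * ‖herm n p.rep q.rep‖ ^ 2 : ℝ) : ℂ) := by
        simp only [herm_add_left, herm_add_right, herm_smul_left, herm_smul_right, hpp, hqq, hqp,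
          ht, star_neg, star_star]
        push_cast
        rw [← Complex.conj_mul', Complex.star_def]
        ring
      rw [normForm_eq, this, Complex.ofReal_re]
      have : 0 < ‖herm n p.rep q.rep‖ := norm_pos_iff.2 hpq0
      nlinarith
    have hne : p.rep + t • q.rep ≠ 0 := by
      intro h
      rw [h] at hN
      simp [normForm] at hN
    have hmem : Projectivization.mk ℂ _ hne ∈ fixedLines g ∩ hyperbolicSpace n :=
      ⟨mk_mem_fixedLines hne hfix, mk_mem_hyperbolicSpace hne hN⟩
    rw [hneg] at hmem
    exact hmem
  rcases lt_or_gt_of_ne ha1 with h | h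
  · refine ⟨b, q.rep, ?_, q.rep_nonzero, hqq, hb⟩
    by_contra! hb1
    have : ‖a‖ * ‖b‖ < 1 := by nlinarith [norm_nonneg a, norm_nonneg b]
    exact this.ne hnab
  · exact ⟨a, p.rep, h, p.rep_nonzero, hpp, ha⟩

/-- Eigenvalues of an isometry with null eigenvector `u` of eigenvalue `z`. -/
theorem eigenvalue_trichotomy {g : GL (Fin (n + 1)) ℂ} (hg : g ∈ SUn1 n) {z w : ℂ}
    {u y : Fin (n + 1) → ℂ} (hu0 : u ≠ 0) (hu : herm n u u = 0)
    (hz : g.val *ᵥ u = z • u) (hy0 : y ≠ 0) (hw : g.val *ᵥ y = w • y) :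
    w = z ∨ w = (star z)⁻¹ ∨ ‖w‖ = 1 := by
  by_cases h1 : ‖w‖ = 1
  · exact .inr (.inr h1)
  by_cases h2 : w = (star z)⁻¹
  · exact .inr (.inl h2)
  left
  -- Invariance of the form makes `y` null as `‖w‖ ≠ 1`, and orthogonal to `u` as `star z * w ≠ 1`;
  -- hence `y` is a multiple of `u`.
  have hyy : herm n y y = 0 := by
    by_contra h0
    have h := herm_mulVec hg y y
    rw [hw, herm_smul_left, herm_smul_right, ← mul_assoc] at h
    have h' := mul_right_cancel₀ h0 (h.trans (one_mul _).symm)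
    have h3 : ‖w‖ * ‖w‖ = 1 := by simpa using congrArg norm h'
    exact h1 (by nlinarith [norm_nonneg w])
  have huy : herm n u y = 0 := by
    by_contra h0
    have h := herm_mulVec hg u y
    rw [hz, hw, herm_smul_left, herm_smul_right, ← mul_assoc] at h
    exact h2 (eq_inv_of_mul_eq_one_right (mul_right_cancel₀ h0 (h.trans (one_mul _).symm)))
  obtain ⟨c, rfl⟩ := exists_smul_eq_of_null hu0 hu hyy huy
  rw [Matrix.mulVec_smul, hz, smul_comm] at hw
  exact (smul_left_injective ℂ hy0 hw).symm

end Hermitian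

/-! ### Eigenvalues of matrices -/

section Eigenvalues

variable {m : Type*} [Fintype m] [DecidableEq m]

theorem isRoot_charpoly_iff {F : Type*} [Field F] (M : Matrix m m F) (w : F) :
    M.charpoly.IsRoot w ↔ ∃ v : m → F, v ≠ 0 ∧ M *ᵥ v = w • v := by
  rw [Polynomial.IsRoot, Matrix.eval_charpoly, ← Matrix.exists_mulVec_eq_zero_iff]
  refine exists_congr fun v => and_congr_right fun _ => ?_
  rw [Matrix.sub_mulVec, sub_eq_zero, eq_comm, Matrix.scalar_apply, ← Matrix.smul_one_eq_diagonal,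
    Matrix.smul_mulVec, Matrix.one_mulVec]

theorem pow_mulVec_eq {F : Type*} [Field F] {M : Matrix m m F} {w : F} {v : m → F}
    (h : M *ᵥ v = w • v) (k : ℕ) : (M ^ k) *ᵥ v = w ^ k • v := by
  induction k with
  | zero => simp
  | succ k ih => rw [pow_succ, ← Matrix.mulVec_mulVec, h, Matrix.mulVec_smul, ih, smul_smul,
      pow_succ']

theorem aeval_mulVec_eq {R F : Type*} [CommRing R] [Field F] [Algebra R F] {M : Matrix m m F}
    {w : F} {v : m → F} (h : M *ᵥ v = w • v) (p : R[X]) :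
    Polynomial.aeval M p *ᵥ v = Polynomial.aeval w p • v := by
  induction p using Polynomial.induction_on' with
  | add p q hp hq => rw [map_add, map_add, Matrix.add_mulVec, hp, hq, add_smul]
  | monomial k a =>
    rw [Polynomial.aeval_monomial, Polynomial.aeval_monomial, ← Matrix.mulVec_mulVec,
      pow_mulVec_eq h, Matrix.mulVec_smul, Matrix.algebraMap_eq_diagonal]
    ext i
    simp [Matrix.mulVec_diagonal, mul_comm, mul_left_comm]

/-- An annihilating polynomial of a matrix vanishes at the eigenvalues. -/
theorem aeval_eq_zero_of_aeval_matrix {R F : Type*} [CommRing R] [Field F] [Algebra R F]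
    {M : Matrix m m F} {w : F} {v : m → F} (hv : v ≠ 0) (h : M *ᵥ v = w • v) {p : R[X]}
    (hp : Polynomial.aeval M p = 0) : Polynomial.aeval w p = 0 := by
  have h1 := aeval_mulVec_eq h p
  rw [hp, Matrix.zero_mulVec, eq_comm, smul_eq_zero] at h1
  exact h1.resolve_right hv

/-- Eigenvalues of the elements of a compact subgroup of `GL` have modulus at most one. -/
theorem norm_eigenvalue_le_one {S : Subgroup (GL m ℂ)} (hS : IsCompact (S : Set (GL m ℂ)))
    {g : GL m ℂ} (hg : g ∈ S) {w : ℂ} {v : m → ℂ} (hv : v ≠ 0) (h : g.val *ᵥ v = w • v) :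
    ‖w‖ ≤ 1 := by
  by_contra! hw
  have hc : Continuous fun x : GL m ℂ => ‖x.val *ᵥ v‖ :=
    (Continuous.matrix_mulVec Units.continuous_val continuous_const).norm
  obtain ⟨C, hC⟩ := (hS.image hc).bddAbove
  have hv' : 0 < ‖v‖ := norm_pos_iff.2 hv
  -- The powers of `g` stay in the compact group, yet `‖w‖ ^ k * ‖v‖` is unbounded.
  obtain ⟨k, hk⟩ := pow_unbounded_of_one_lt (C / ‖v‖) hw
  have h1 := hC ⟨g ^ k, S.pow_mem hg k, rfl⟩
  simp only [Units.val_pow_eq_pow_val, pow_mulVec_eq h, norm_smul, norm_pow] at h1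
  rw [div_lt_iff₀ hv'] at hk
  exact hk.not_ge h1

theorem norm_eigenvalue_eq_one {S : Subgroup (GL m ℂ)} (hS : IsCompact (S : Set (GL m ℂ)))
    {g : GL m ℂ} (hg : g ∈ S) {w : ℂ} {v : m → ℂ} (hv : v ≠ 0) (h : g.val *ᵥ v = w • v) :
    ‖w‖ = 1 := by
  refine le_antisymm (norm_eigenvalue_le_one hS hg hv h) ?_
  have hv1 : v = w • g⁻¹.val *ᵥ v := by
    rw [← Matrix.mulVec_smul, ← h, Matrix.mulVec_mulVec, ← Units.val_mul, inv_mul_cancel,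
      Units.val_one, Matrix.one_mulVec]
  have hw : w ≠ 0 := by
    rintro rfl
    exact hv (by rw [hv1, zero_smul])
  have h1 : g⁻¹.val *ᵥ v = w⁻¹ • v := by
    conv_rhs => rw [hv1]
    rw [smul_smul, inv_mul_cancel₀ hw, one_smul]
  have h2 := norm_eigenvalue_le_one hS (S.inv_mem hg) hv h1
  rw [norm_inv] at h2
  exact (inv_le_one₀ (norm_pos_iff.2 hw)).1 h2

/-- If the special unitary group of a nondegenerate form is compact, the eigenvalues of all
isometries of the form have modulus one. -/
theorem norm_eigenvalue_of_isCompact {m : ℕ} {H : Matrix (Fin m) (Fin m) ℂ} (hH : IsUnit H)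
    (hc : IsCompact (specialUnitary H : Set (GL (Fin m) ℂ))) {g : Matrix (Fin m) (Fin m) ℂ}
    (hg : gᴴ * H * g = H) {w : ℂ} {v : Fin m → ℂ} (hv : v ≠ 0) (h : g *ᵥ v = w • v) :
    ‖w‖ = 1 := by
  have hm : m ≠ 0 := by
    rintro rfl
    exact hv (Subsingleton.elim _ _)
  have hdH : H.det ≠ 0 := ((Matrix.isUnit_iff_isUnit_det H).1 hH).ne_zero
  have hd : star g.det * g.det = 1 := by
    have h1 := congrArg Matrix.det hg
    rw [Matrix.det_mul, Matrix.det_mul, Matrix.det_conjTranspose, mul_right_comm] at h1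
    exact mul_right_cancel₀ hdH (h1.trans (one_mul _).symm)
  have hnd : ‖g.det‖ = 1 := by
    have h1 : ‖g.det‖ * ‖g.det‖ = 1 := by simpa using congrArg norm hd
    nlinarith [norm_nonneg g.det]
  -- The determinant of `g` is only known to have modulus one. Scaling by the unimodular `c` puts
  -- `g` in the special unitary group without changing moduli of eigenvalues.
  obtain ⟨c, hcm⟩ := IsAlgClosed.exists_pow_nat_eq (g.det)⁻¹ (Nat.pos_of_ne_zero hm)
  have hnc : ‖c‖ = 1 := by
    have h1 := congrArg norm hcm
    rw [norm_pow, norm_inv, hnd, inv_one] at h1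
    exact (pow_eq_one_iff_of_nonneg (norm_nonneg c) hm).1 h1
  have hdet : (c • g).det = 1 := by
    rw [Matrix.det_smul, Fintype.card_fin, hcm, inv_mul_cancel₀]
    exact right_ne_zero_of_mul (hd.trans_ne one_ne_zero)
  have hu : IsUnit (c • g) := (Matrix.isUnit_iff_isUnit_det _).2 (by rw [hdet]; exact isUnit_one)
  obtain ⟨g', hg'⟩ := hu
  have hmem : g' ∈ specialUnitary H := by
    refine ⟨?_, by rw [hg', hdet]⟩
    rw [hg', Matrix.conjTranspose_smul, Matrix.smul_mul, Matrix.smul_mul, Matrix.mul_smul, smul_smul,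
      hg, Complex.star_def, Complex.conj_mul', hnc]
    simp
  have h1 := norm_eigenvalue_eq_one hc hmem hv
    (show g'.val *ᵥ v = (c * w) • v by rw [hg', Matrix.smul_mulVec, h, smul_smul])
  rwa [norm_mul, hnc, one_mul] at h1

end Eigenvalues

/-! ### Scalar extension of central simple algebras -/

section CentralSimple

variable {l B F C : Type*} [Field l] [Ring B] [Algebra l B] [Algebra.IsCentral l B]
  [IsSimpleRing B] [Field F] [Algebra l F] [Ring C] [Nontrivial C] [Algebra F C]

/-- A ring homomorphism from a central simple `l`-algebra to an algebra over an extension field `F`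
of `l` preserves linear independence: it extends to an injection of the scalar extension. -/
theorem eq_zero_of_sum_smul_eq_zero (f : B →+* C)
    (hf : ∀ a, f (algebraMap l B a) = algebraMap F C (algebraMap l F a)) {ι : Type*}
    {c : ι → F} (hc : LinearIndependent l c) (S : Finset ι) (b : ι → B)
    (h : ∑ i ∈ S, c i • f (b i) = 0) : ∀ i ∈ S, b i = 0 := by
  classical
  induction S using Finset.induction_on generalizing b with
  | empty => simp
  | insert j S hj ih =>
    suffices hbj : b j = 0 by
      rw [Finset.sum_insert hj, hbj, map_zero, smul_zero, zero_add] at h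
      intro i hi
      rcases Finset.mem_insert.1 hi with rfl | hi
      · exact hbj
      · exact ih b h i hi
    by_contra hbj
    -- The `j`-th entries of all relations supported on `insert j S` form a two-sided ideal. If it
    -- is nonzero, simplicity gives a relation `e` with `e j = 1`.
    let I : TwoSidedIdeal B := TwoSidedIdeal.mk'
      {x | ∃ b : ι → B, ∑ i ∈ insert j S, c i • f (b i) = 0 ∧ b j = x}
      ⟨0, by simp, rfl⟩
      (by
        rintro _ _ ⟨b, hb, rfl⟩ ⟨b', hb', rfl⟩
        exact ⟨b + b', by simp only [Pi.add_apply, map_add, smul_add, Finset.sum_add_distrib, hb,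
          hb', add_zero], rfl⟩)
      (by
        rintro _ ⟨b, hb, rfl⟩
        exact ⟨-b, by simp only [Pi.neg_apply, map_neg, smul_neg, Finset.sum_neg_distrib, hb,
          neg_zero], rfl⟩)
      (by
        rintro x _ ⟨b, hb, rfl⟩
        exact ⟨fun i => x * b i, by simp only [map_mul, ← mul_smul_comm, ← Finset.mul_sum, hb,
          mul_zero], rfl⟩)
      (by
        rintro _ x ⟨b, hb, rfl⟩
        exact ⟨fun i => b i * x, by simp only [map_mul, ← smul_mul_assoc, ← Finset.sum_mul, hb,
          zero_mul], rfl⟩)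
    have h1 : (1 : B) ∈ I := by
      refine IsSimpleRing.one_mem_of_ne_zero_mem I hbj ?_
      rw [TwoSidedIdeal.mem_mk']
      exact ⟨b, h, rfl⟩
    rw [TwoSidedIdeal.mem_mk'] at h1
    obtain ⟨e, he, hej⟩ := h1
    -- The commutator of `y` with `e` is a relation without `j`-th term, so it vanishes by
    -- induction. Hence all `e i` are scalars in `l`, against the independence of `c`.
    have hcomm (y : B) : ∀ i ∈ S, y * e i - e i * y = 0 := by
      apply ih fun i => y * e i - e i * y
      have h2 : ∑ i ∈ insert j S, c i • f (y * e i - e i * y) = 0 := by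
        have hl : ∑ i ∈ insert j S, c i • f (y * e i) = 0 := by
          simp only [map_mul, ← mul_smul_comm, ← Finset.mul_sum, he, mul_zero]
        have hr : ∑ i ∈ insert j S, c i • f (e i * y) = 0 := by
          simp only [map_mul, ← smul_mul_assoc, ← Finset.sum_mul, he, zero_mul]
        simp only [map_sub, smul_sub, Finset.sum_sub_distrib, hl, hr, sub_zero]
      rwa [Finset.sum_insert hj, hej, mul_one, one_mul, sub_self, map_zero, smul_zero,
        zero_add] at h2
    have hcent : ∀ i ∈ insert j S, ∃ a : l, algebraMap l B a = e i := by
      intro i hi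
      have : e i ∈ Subalgebra.center l B := by
        rw [Subalgebra.mem_center_iff]
        intro y
        rcases Finset.mem_insert.1 hi with rfl | hi
        · rw [hej, mul_one, one_mul]
        · exact sub_eq_zero.1 (hcomm y i hi)
      exact Algebra.mem_bot.1 (Algebra.IsCentral.out this)
    choose! a ha using hcent
    have h3 : ∑ i ∈ insert j S, a i • c i = 0 := by
      apply (algebraMap F C).injective
      rw [map_zero, ← he, map_sum]
      refine Finset.sum_congr rfl fun i hi => ?_
      rw [← ha i hi, hf, Algebra.smul_def, Algebra.smul_def, map_mul, Algebra.commutes]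
    have h4 := linearIndependent_iff'.1 hc _ a h3 j (Finset.mem_insert_self j S)
    have h5 := ha j (Finset.mem_insert_self j S)
    rw [h4, map_zero, hej] at h5
    exact zero_ne_one h5

/-- The roots of the minimal polynomial of `x` over `l` are roots of every polynomial that
annihilates the image of `x` in an algebra over an extension field. -/
theorem isRoot_of_aeval_minpoly_eq_zero (f : B →+* C)
    (hf : ∀ a, f (algebraMap l B a) = algebraMap F C (algebraMap l F a)) (x : B) {w : F}
    (hw : Polynomial.aeval w (minpoly l x) = 0) {p : F[X]} (hp : Polynomial.aeval (f x) p = 0) :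
    p.IsRoot w := by
  classical
  -- Expanding the coefficients of `p` in a basis of `F` over `l` gives `p = ∑ β j * P j` with `P j`
  -- over `l`. Each `P j` kills `x` separately, so the minimal polynomial divides it.
  let β := Module.Basis.ofVectorSpace l F
  let J := p.support.biUnion fun k => (β.repr (p.coeff k)).support
  have hcoeff (k : ℕ) : ∑ j ∈ J, algebraMap l F (β.repr (p.coeff k) j) * β j = p.coeff k := by
    conv_rhs => rw [← β.linearCombination_repr (p.coeff k)]
    rw [Finsupp.linearCombination_apply, Finsupp.sum]
    simp only [Algebra.smul_def]
    symm
    by_cases hk : k ∈ p.support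
    · refine Finset.sum_subset (Finset.subset_biUnion_of_mem
        (fun k => (β.repr (p.coeff k)).support) hk) fun j _ hj => ?_
      rw [Finsupp.notMem_support_iff.1 hj, map_zero, zero_mul]
    · rw [Polynomial.notMem_support_iff.1 hk]
      simp
  let P (j) : l[X] := ∑ k ∈ p.support, Polynomial.monomial k (β.repr (p.coeff k) j)
  have hP : ∀ j ∈ J, Polynomial.aeval x (P j) = 0 := by
    apply eq_zero_of_sum_smul_eq_zero f hf β.linearIndependent
    rw [← hp, Polynomial.aeval_eq_sum_range, ← Polynomial.sum_over_range' p (by simp) _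
      (Nat.lt_succ_self _) (f := fun k a => a • f x ^ k), Polynomial.sum]
    simp only [P, map_sum, Finset.smul_sum, Polynomial.aeval_monomial, map_mul, map_pow, hf]
    rw [Finset.sum_comm]
    refine Finset.sum_congr rfl fun k _ => ?_
    conv_rhs => rw [← hcoeff k, Finset.sum_smul]
    refine Finset.sum_congr rfl fun j _ => ?_
    rw [← Algebra.smul_def, smul_smul, mul_comm]
  have hPw : ∀ j ∈ J, Polynomial.aeval w (P j) = 0 := by
    intro j hj
    obtain ⟨q, hq⟩ := minpoly.dvd l x (hP j hj)
    rw [hq, map_mul, hw, zero_mul]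
  rw [Polynomial.IsRoot, Polynomial.eval_eq_sum, Polynomial.sum]
  calc ∑ k ∈ p.support, p.coeff k * w ^ k
      = ∑ k ∈ p.support, ∑ j ∈ J, algebraMap l F (β.repr (p.coeff k) j) * β j * w ^ k := by
        refine Finset.sum_congr rfl fun k _ => ?_
        rw [← Finset.sum_mul, hcoeff]
    _ = ∑ j ∈ J, β j * Polynomial.aeval w (P j) := by
        rw [Finset.sum_comm]
        simp only [P, map_sum, Polynomial.aeval_monomial, Finset.mul_sum]
        refine Finset.sum_congr rfl fun j _ => Finset.sum_congr rfl fun k _ => ?_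
        ring
    _ = 0 := Finset.sum_eq_zero fun j hj => by rw [hPw j hj, mul_zero]

end CentralSimple

/-! ### Embeddings of number fields -/

section Embeddings

/-- If `z` is a root of the image of `q` under an embedding, each Galois conjugate of `z` is a root
of the image of `q` under some embedding. -/
theorem exists_embedding_of_minpoly_eq {l : Type*} [Field l] [NumberField l] (τ₁ : l →+* ℂ)
    {q : l[X]} {z w : ℂ} (hz : IsIntegral ℚ z) (hzw : minpoly ℚ z = minpoly ℚ w)
    (hq : q.eval₂ τ₁ z = 0) : ∃ τ : l →+* ℂ, q.eval₂ τ w = 0 := by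
  have hw : IsIntegral ℚ w := by
    -- The minimal polynomial of a non-integral element is zero by convention.
    by_contra h
    exact minpoly.ne_zero hz (hzw.trans (minpoly.eq_zero h))
  let Q := algebraicClosure ℚ ℂ
  have : IsAlgClosure ℚ Q := algebraicClosure.isAlgClosure ℚ ℂ
  have : Normal ℚ Q := IsAlgClosure.normal ℚ Q
  let z' : Q := ⟨z, mem_algebraicClosure_iff'.2 hz⟩
  let w' : Q := ⟨w, mem_algebraicClosure_iff'.2 hw⟩
  have hconj : IsConjRoot ℚ w' z' := by
    change minpoly ℚ w' = minpoly ℚ z'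
    rw [← minpoly.algebraMap_eq (algebraMap Q ℂ).injective w',
      ← minpoly.algebraMap_eq (algebraMap Q ℂ).injective z']
    exact hzw.symm
  -- The embedding sought is `τ₁` followed by an automorphism `σ` of the algebraic numbers that
  -- sends `z` to `w`.
  obtain ⟨σ, hσ⟩ := isConjRoot_iff_exists_algEquiv.1 hconj
  let ρ : l →+* Q := τ₁.codRestrict Q.toSubring fun a =>
    mem_algebraicClosure_iff'.2 ((Algebra.IsIntegral.isIntegral (R := ℚ) a).map τ₁.toRatAlgHom)
  have hρ : q.eval₂ ρ z' = 0 := by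
    apply (algebraMap Q ℂ).injective
    rw [Polynomial.hom_eval₂, map_zero]
    exact hq
  refine ⟨(algebraMap Q ℂ).comp ((σ : Q →+* Q).comp ρ), ?_⟩
  have h1 := congrArg (fun t => algebraMap Q ℂ (σ t)) hρ
  simp only [map_zero] at h1
  rw [← RingHom.coe_coe σ, Polynomial.hom_eval₂, Polynomial.hom_eval₂] at h1
  simpa [hσ] using h1

/-- A totally complex quadratic extension has two embeddings above each embedding of its totally
real base field, and these are complex conjugate. -/
theorem eq_or_eq_conjugate_of_comp_eq {K l : Type*} [Field K] [NumberField K]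
    [NumberField.IsTotallyReal K] [Field l] [NumberField l] [NumberField.IsTotallyComplex l]
    [Algebra K l] (hKl : Module.finrank K l = 2) {τ τ₁ : l →+* ℂ}
    (h : τ.comp (algebraMap K l) = τ₁.comp (algebraMap K l)) :
    τ = τ₁ ∨ τ = NumberField.ComplexEmbedding.conjugate τ₁ := by
  classical
  let _ : Algebra K ℂ := (τ₁.comp (algebraMap K l)).toAlgebra
  have hfin : FiniteDimensional K l := FiniteDimensional.of_finrank_pos (by omega)
  have hcard : Fintype.card (l →ₐ[K] ℂ) = 2 := (AlgHom.card K l ℂ).trans hKl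
  have hconj : (NumberField.ComplexEmbedding.conjugate τ₁).comp (algebraMap K l) =
      τ₁.comp (algebraMap K l) := NumberField.ComplexEmbedding.isReal_iff.1
    (NumberField.IsTotallyReal.complexEmbedding_isReal (τ₁.comp (algebraMap K l)))
  let f : l →ₐ[K] ℂ := { τ with commutes' := fun a => RingHom.congr_fun h a }
  let f₁ : l →ₐ[K] ℂ := { τ₁ with commutes' := fun a => rfl }
  let f₂ : l →ₐ[K] ℂ :=
    { NumberField.ComplexEmbedding.conjugate τ₁ with
      commutes' := fun a => RingHom.congr_fun hconj a }
  by_contra! hne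
  have h1 : f ≠ f₁ := fun e => hne.1 (congrArg (fun t : l →ₐ[K] ℂ => (t : l →+* ℂ)) e)
  have h2 : f ≠ f₂ := fun e => hne.2 (congrArg (fun t : l →ₐ[K] ℂ => (t : l →+* ℂ)) e)
  have h3 : f₁ ≠ f₂ := fun e =>
    NumberField.IsTotallyComplex.complexEmbedding_not_isReal τ₁
      (NumberField.ComplexEmbedding.isReal_iff.2
        (congrArg (fun t : l →ₐ[K] ℂ => (t : l →+* ℂ)) e).symm)
  -- A third embedding over `K` would exceed the degree of `l` over `K`.
  have h4 := Finset.card_le_univ ({f, f₁, f₂} : Finset (l →ₐ[K] ℂ))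
  rw [Finset.card_eq_three.2 ⟨f, f₁, f₂, h1, h2, h3, rfl⟩, hcard] at h4
  omega

end Embeddings

/-! ### Integrality -/

/-- Matrices over a subring that is finitely generated as a group are integral over `ℤ`. -/
theorem isIntegral_of_mem_matrix {A : Type*} [Ring A] {O : Subring A}
    (hO : O.toAddSubgroup.FG) {r : ℕ} {y : Matrix (Fin r) (Fin r) A}
    (hy : y ∈ O.matrix (n := Fin r)) : IsIntegral ℤ y := by
  have : Module.Finite ℤ O := by
    have : AddGroup.FG O := (AddGroup.fg_iff_addSubgroup_fg O.toAddSubgroup).2 hO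
    exact Module.Finite.iff_addGroup_fg.2 this
  let Y : Matrix (Fin r) (Fin r) O := fun i j => ⟨y i j, hy i j⟩
  have : Module.Finite ℤ (Matrix (Fin r) (Fin r) O) :=
    inferInstanceAs (Module.Finite ℤ (Fin r → Fin r → O))
  have hY : IsIntegral ℤ Y := IsIntegral.of_finite ℤ Y
  exact hY.map (O.subtype.mapMatrix : Matrix (Fin r) (Fin r) O →+* _).toIntAlgHom

/-! ### Eigenvalues and isometries in a splitting -/

namespace Splitting

variable {l A : Type*} [Field l] [Ring A] [Algebra l A] [StarRing A] {τ : l →+* ℂ} {r m : ℕ}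

/-- In every splitting, the eigenvalues of `x` are the roots of its minimal polynomial over `l`. -/
theorem eval₂_minpoly_eq_zero_iff [Algebra.IsCentral l A] [IsSimpleRing A] [NeZero r] [NeZero m]
    (s : Splitting (A := A) τ r m) (x : Matrix (Fin r) (Fin r) A) (w : ℂ) :
    (minpoly l x).eval₂ τ w = 0 ↔ ∃ v : Fin m → ℂ, v ≠ 0 ∧ s.toHom x *ᵥ v = w • v := by
  let _ : Algebra l ℂ := τ.toAlgebra
  constructor
  · intro h
    rw [← isRoot_charpoly_iff]
    refine isRoot_of_aeval_minpoly_eq_zero s.toHom (fun a => ?_) x h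
      (Matrix.aeval_self_charpoly (s.toHom x))
    rw [s.map_scalar, Matrix.algebraMap_eq_diagonal]
    rfl
  · rintro ⟨v, hv, h⟩
    let f : Matrix (Fin r) (Fin r) A →ₐ[l] Matrix (Fin m) (Fin m) ℂ :=
      { s.toHom with commutes' := s.map_scalar }
    refine aeval_eq_zero_of_aeval_matrix hv h ?_
    change Polynomial.aeval (f x) _ = 0
    rw [Polynomial.aeval_algHom_apply, minpoly.aeval, map_zero]

theorem isUnit_form (s : Splitting (A := A) τ r m) {h : Matrix (Fin r) (Fin r) A}
    (hh : IsUnit h) : IsUnit (s.form h) := s.isUnit.mul (hh.map s.toHom)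

/-- Moving the adjoint across `E` transfers the isometry identity to any splitting. Nothing is
claimed about the determinant there. -/
theorem conjTranspose_mul_form_mul (s : Splitting (A := A) τ r m)
    {h x : Matrix (Fin r) (Fin r) A} (hx : xᴴ * h * x = h) :
    (s.toHom x)ᴴ * s.form h * s.toHom x = s.form h := by
  rw [form, ← mul_assoc, ← s.adjoint, mul_assoc, mul_assoc, ← map_mul, ← map_mul, ← mul_assoc, hx]

end Splitting

end ComplexHyperbolic

/-! ### Dominant eigenvalues of hyperbolic elements are complex Salem numbers -/

theorem mainTheorem2 (K l A : Type*) [Field K] [NumberField K] [NumberField.IsTotallyReal K]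
    [Field l] [NumberField l] [NumberField.IsTotallyComplex l] [Algebra K l]
    (hKl : Module.finrank K l = 2)
    [Ring A] [Algebra l A] [Algebra.IsCentral l A] [IsSimpleRing A] [FiniteDimensional l A]
    [StarRing A] (n : ℕ) (Γ : Subgroup (GL (Fin (n + 1)) ℂ))
    (hΓ : ComplexHyperbolic.IsArithmeticLattice K l A Γ)
    (γ : GL (Fin (n + 1)) ℂ) (hγ : γ ∈ Γ) (hyp : ComplexHyperbolic.IsHyperbolic γ) :
    ∃ z : ℂ, z ∈ (γ : Matrix (Fin (n + 1)) (Fin (n + 1)) ℂ).charpoly.roots ∧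
      (∀ w ∈ (γ : Matrix (Fin (n + 1)) (Fin (n + 1)) ℂ).charpoly.roots, w ≠ z → ‖w‖ < ‖z‖) ∧
      ComplexHyperbolic.IsComplexSalem z := by
  open ComplexHyperbolic in
  obtain ⟨z, u, hz1, hu0, hu, hzu⟩ := hyp.exists_eigenvectors
  obtain ⟨-, r, d, h, O, τ₁, s₁, -, hrd, -, hh, hO, -, hcpt, hSU, hrat, hcomm⟩ := hΓ
  have hr : NeZero r := ⟨by rintro rfl; omega⟩
  have mem_roots (w : ℂ) : w ∈ γ.val.charpoly.roots ↔ ∃ v, v ≠ 0 ∧ γ.val *ᵥ v = w • v := by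
    rw [Polynomial.mem_roots (Matrix.charpoly_monic _).ne_zero, isRoot_charpoly_iff]
  have tri (w : ℂ) (hw : ∃ v, v ≠ 0 ∧ γ.val *ᵥ v = w • v) :
      w = z ∨ w = (star z)⁻¹ ∨ ‖w‖ = 1 := by
    obtain ⟨v, hv, hvw⟩ := hw
    exact eigenvalue_trichotomy (hSU hγ) hu0 hu hzu hv hvw
  obtain ⟨x, ⟨hxh, -⟩, hxγ⟩ := hrat hγ
  have hxγ' : s₁.toHom x = γ.val := congrArg Units.val hxγ
  have hzint : IsIntegral ℤ z := by
    -- By commensurability a positive power of `γ` lies in the image of `SU(h, O)`; then `z ^ k` is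
    -- integral, and so is `z`.
    obtain ⟨k, hk, -, hmem⟩ := Subgroup.exists_pow_mem_of_relIndex_ne_zero hcomm.2 hγ
    obtain ⟨y, hy, hyγ⟩ := hmem.1
    have hyγ' : s₁.toHom y = γ.val ^ k := congrArg Units.val hyγ
    have hyO : y.val ∈ O.matrix (n := Fin r) := hy.2.1
    obtain ⟨p, hp, hpy⟩ := (isIntegral_of_mem_matrix hO.fg hyO).map s₁.toHom.toIntAlgHom
    refine IsIntegral.of_pow hk ⟨p, hp, ?_⟩
    refine aeval_eq_zero_of_aeval_matrix hu0 (pow_mulVec_eq hzu k) ?_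
    rw [← hyγ']
    exact hpy
  have hz1' : ‖(star z)⁻¹‖ < 1 := by
    rw [norm_inv, norm_star]
    exact inv_lt_one_of_one_lt₀ hz1
  refine ⟨z, (mem_roots z).2 ⟨u, hu0, hzu⟩, fun w hw hwz => ?_, hz1, minpoly ℤ z,
    minpoly.monic hzint, minpoly.aeval ℤ z, fun w hw hw1 hw2 hw3 hw4 => ?_⟩
  · rcases tri w ((mem_roots w).1 hw) with rfl | rfl | h1
    · exact absurd rfl hwz
    · exact hz1'.trans hz1
    · rwa [h1]
  · have hzQ : IsIntegral ℚ z := hzint.tower_top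
    have hmin : minpoly ℚ z = minpoly ℚ w := by
      refine minpoly.eq_of_irreducible_of_monic (minpoly.irreducible hzQ) ?_ (minpoly.monic hzQ)
      rw [minpoly.isIntegrallyClosed_eq_field_fractions' ℚ hzint, Polynomial.aeval_map_algebraMap,
        hw]
    obtain ⟨τ, hτ⟩ := exists_embedding_of_minpoly_eq τ₁ (q := minpoly l x.val) hzQ hmin
      ((s₁.eval₂_minpoly_eq_zero_iff _ z).2 ⟨u, hu0, by rw [hxγ', hzu]⟩)
    by_cases hτK : τ.comp (algebraMap K l) = τ₁.comp (algebraMap K l)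
    · rcases eq_or_eq_conjugate_of_comp_eq hKl hτK with rfl | rfl
      · rw [s₁.eval₂_minpoly_eq_zero_iff, hxγ'] at hτ
        rcases tri w hτ with h1 | h1 | h1
        · exact absurd h1 hw1
        · exact absurd h1 hw4
        · exact h1
      -- At the conjugate embedding, complex conjugation makes `star w` an eigenvalue of `γ`, which
      -- accounts for the exceptional values `star z` and `z⁻¹`.
      · have hτ' : (minpoly l x.val).eval₂ τ₁ (star w) = 0 := by
          have h1 := congrArg (starRingEnd ℂ) hτ
          rw [Polynomial.hom_eval₂, map_zero] at h1
          convert h1 using 2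
          · ext a
            exact (Complex.conj_conj _).symm
          · rfl
        rw [s₁.eval₂_minpoly_eq_zero_iff, hxγ'] at hτ'
        rcases tri _ hτ' with h1 | h1 | h1
        · exact absurd (by rw [← h1, star_star]) hw2
        · exact absurd (by rw [← star_star w, h1, star_inv₀, star_star]) hw3
        · rwa [norm_star] at h1
    · obtain ⟨s, hs⟩ := hcpt τ hτK
      obtain ⟨v, hv, hvw⟩ := (s.eval₂_minpoly_eq_zero_iff x.val w).1 hτ
      exact norm_eigenvalue_of_isCompact (s.isUnit_form hh) hs
        (s.conjTranspose_mul_form_mul hxh) hv hvw
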